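/- For each $n\in\{1,2,\dots\}$ let $X=X_n\in\mathbb R^{n\times p_n}$ and $Z=Z_n\in\mathbb R^{n\times q_n}$ be non-random matrices, let $r_n\ge 1$, and for $v\in\mathbb R^{r_n}$ let $\Psi_n(v)\in\mathbb R^{q_n\times q_n}$ be a symmetric matrix each of whose entries is either fixed at zero or equal to one of $v_1,\dots,v_{r_n-1}$ (in positions not depending on $v$), each of these occurring at least once. Put $$\Sigma_n(v)=Z\Psi_n(v)Z^{\mathsf T}+v_{r_n}I_n,\qquad \mathbb P_n=\{\psi\in\mathbb R^{r_n}:\Psi_n(\psi)\text{ is positive semi-definite},\ \psi_{r_n}>0\}.$$ For $\beta\in\mathbb R^{p_n}$ and $\psi\in\mathbb P_n$ consider the model $Y_n\sim \mathrm N(X\beta,\Sigma_n(\psi))$, whose log-likelihood is, up to a constant, $$\ell_n(\beta,\psi)=-\tfrac12\{\log|\Sigma_n(\psi)|+(Y_n-X\beta)^{\mathsf T}\Sigma_n(\psi)^{-1}(Y_n-X\beta)\}.$$ For the model with known $\beta=0$, let $S_n(\psi)=\partial \ell_n(0,\psi)/\partial\psi\in\mathbb R^{r_n}$, let $\mathcal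 I_n(\psi)=\mathrm{cov}_\psi\{S_n(\psi)\}$ and, when $\mathcal I_n(\psi)$ is invertible, $W_n^S(\psi)=\mathcal I_n(\psi)^{-1/2}S_n(\psi)$. For the model with unknown $\beta$ and $\theta=(\beta,\psi)$, let $S_n(\theta)=\partial\ell_n(\theta)/\partial\theta\in\mathbb R^{p_n+r_n}$, $\mathcal I_n(\theta)=\mathrm{cov}_\theta\{S_n(\theta)\}$ and, when $\mathcal I_n(\theta)$ is invertible, $W_n^S(\theta)=\mathcal I_n(\theta)^{-1/2}S_n(\theta)$. Here $M^{-1/2}$ is the symmetric inverse square root of a positive definite $M$. For $v\in\mathbb R^{r_n}$ and $\psi\in\mathbb P_n$ let $A_n(v,\psi)=\Sigma_n(\psi)^{-1/2}\Sigma_n(v)\Sigma_n(\psi)^{-1/2}$ and $$a_n(v,\psi)=\frac{\|A_n(v,\psi)\|}{\|A_n(v,\psi)\|_F}\ \text{ if } \|A_n(v,\psi)\|_F>0,\qquad a_n(v,\psi)=1\ \text{ otherwise},$$ where $\|\cdot\|$ and $\|\cdot\|_F$ are the spectral and Frobenius norms. Write $\mathbb S^{d-1}$ for the unit sphere of $\mathbb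 R^d$. **Theorem.** Let $\psi_n\in\mathbb P_n$ for every $n$, and suppose there are $\bar a_n$ with $\sup_{v\in\mathbb S^{r_n-1}}a_n(v,\psi_n)\le\bar a_n$ for every $n$ and $\lim_{n\to\infty}\bar a_n=0$. 1. If $Y_n\sim\mathrm N(0,\Sigma_n(\psi_n))$ for every $n$ (that is, $\beta=0$ is known), then $\mathcal I_n(\psi_n)$ is positive definite for all large $n$, and for any $v_n\in\mathbb S^{r_n-1}$, $v_n^{\mathsf T}W_n^S(\psi_n)\to\mathrm N(0,1)$ in distribution as $n\to\infty$. 2. If in addition $X_n$ has full column rank for every $n$, then for any $\beta_n\in\mathbb R^{p_n}$, with $\theta_n=(\beta_n,\psi_n)$ and $Y_n\sim\mathrm N(X_n\beta_n,\Sigma_n(\psi_n))$ for every $n$, the matrix $\mathcal I_n(\theta_n)$ is positive definite for all large $n$, and for any $u_n\in\mathbb S^{p_n+r_n-1}$, $u_n^{\mathsf T}W_n^S(\theta_n)\to\mathrm N(0,1)$ in distribution as $n\to\infty$. The dimensions $p_n$, $q_n$, $r_n$ may depend on $n$ in any way. -/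

import Mathlib

open MeasureTheory ProbabilityTheory Filter
open scoped Matrix Topology

/-- The spectral norm of a real square matrix. -/
noncomputable def matSpectralNorm {ι : Type*} [Fintype ι] [DecidableEq ι]
    (M : Matrix ι ι ℝ) : ℝ :=
  ‖Matrix.toEuclideanCLM (n := ι) (𝕜 := ℝ) M‖

/-- The Frobenius norm of a real square matrix. -/
noncomputable def matFrobeniusNorm {ι : Type*} [Fintype ι] (M : Matrix ι ι ℝ) : ℝ :=
  √(∑ i, ∑ j, M i j ^ 2)

/-- The symmetric inverse square root `M^{-1/2}` of a symmetric positive definite matrix, through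
the functional calculus of symmetric matrices. -/
noncomputable def matInvSqrt {ι : Type*} [Fintype ι] [DecidableEq ι]
    (M : Matrix ι ι ℝ) : Matrix ι ι ℝ :=
  cfc (fun x : ℝ => (√x)⁻¹) M

/-- The non-random ingredients of a linear mixed model with `n` observations, `p` fixed effects,
`q` random effects and `r = s + 1` covariance parameters `ψ = (ψ_1, …, ψ_s, ψ_r)`, the last of which
is the error variance.

Each entry of the covariance matrix `Ψ` of the random effects is either known to be zero
(`pattern i j = none`) or equal to one of `ψ_1, …, ψ_s` (`pattern i j = some k`);
`Ψ` is symmetric, and each of `ψ_1, …, ψ_s` occurs in it. -/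
structure MixedModel (n p q s : ℕ) where
  /-- The design matrix of the fixed effects. -/
  X : Matrix (Fin n) (Fin p) ℝ
  /-- The design matrix of the random effects. -/
  Z : Matrix (Fin n) (Fin q) ℝ
  /-- Which covariance parameter stands at which entry of `Ψ`. -/
  pattern : Fin q → Fin q → Option (Fin s)
  pattern_symm : ∀ i j, pattern i j = pattern j i
  pattern_surj : ∀ k, ∃ i j, pattern i j = some k

namespace MixedModel

variable {n p q s : ℕ} (M : MixedModel n p q s)

/-- `Ψ(v)`, for an arbitrary `v ∈ ℝ^r`. -/
def Psi (v : EuclideanSpace ℝ (Fin (s + 1))) : Matrix (Fin q) (Fin q) ℝ :=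
  Matrix.of fun i j => (M.pattern i j).elim 0 fun k => v k.castSucc

/-- `Σ(v) = Z Ψ(v) Zᵀ + v_r I_n`, for an arbitrary `v ∈ ℝ^r`. -/
def Sigma (v : EuclideanSpace ℝ (Fin (s + 1))) : Matrix (Fin n) (Fin n) ℝ :=
  M.Z * M.Psi v * M.Zᵀ + v (Fin.last s) • (1 : Matrix (Fin n) (Fin n) ℝ)

/-- The parameter set `ℙ = {ψ ∈ ℝ^r : Ψ(ψ) ≥ 0, ψ_r > 0}`. -/
def paramSet : Set (EuclideanSpace ℝ (Fin (s + 1))) :=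
  {ψ | (M.Psi ψ).PosSemidef ∧ 0 < ψ (Fin.last s)}

/-- The mean vector `X β`. -/
noncomputable def mean (β : EuclideanSpace ℝ (Fin p)) : EuclideanSpace ℝ (Fin n) :=
  WithLp.toLp 2 (M.X *ᵥ β.ofLp)

/-- The distribution `N(X β, Σ(ψ))` of the response vector. -/
noncomputable def law (β : EuclideanSpace ℝ (Fin p)) (ψ : EuclideanSpace ℝ (Fin (s + 1))) :
    Measure (EuclideanSpace ℝ (Fin n)) :=
  multivariateGaussian (M.mean β) (M.Sigma ψ)

/-- The log-likelihood, up to a constant,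
`ℓ(β, ψ; y) = -(1/2) {log |Σ(ψ)| + (y - X β)ᵀ Σ(ψ)⁻¹ (y - X β)}`. -/
noncomputable def logLik (β : EuclideanSpace ℝ (Fin p)) (ψ : EuclideanSpace ℝ (Fin (s + 1)))
    (y : EuclideanSpace ℝ (Fin n)) : ℝ :=
  -(1 / 2) * (Real.log (M.Sigma ψ).det +
    (y - M.mean β).ofLp ⬝ᵥ ((M.Sigma ψ)⁻¹ *ᵥ (y - M.mean β).ofLp))

/-- `A(v, ψ) = Σ(ψ)^{-1/2} Σ(v) Σ(ψ)^{-1/2}`. -/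
noncomputable def A (v ψ : EuclideanSpace ℝ (Fin (s + 1))) : Matrix (Fin n) (Fin n) ℝ :=
  matInvSqrt (M.Sigma ψ) * M.Sigma v * matInvSqrt (M.Sigma ψ)

open Classical in
/-- `a(v, ψ) = ‖A(v, ψ)‖ / ‖A(v, ψ)‖_F` if `‖A(v, ψ)‖_F > 0`, and `a(v, ψ) = 1` otherwise. -/
noncomputable def a (v ψ : EuclideanSpace ℝ (Fin (s + 1))) : ℝ :=
  if 0 < matFrobeniusNorm (M.A v ψ) then
    matSpectralNorm (M.A v ψ) / matFrobeniusNorm (M.A v ψ)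
  else 1

/-! ### Inference on `ψ` with known `β` -/

/-- The score `S(ψ; β) = ∂ℓ(β, ψ)/∂ψ ∈ ℝ^r` for `ψ`, at the data `y`. -/
noncomputable def scorePsi (β : EuclideanSpace ℝ (Fin p)) (ψ : EuclideanSpace ℝ (Fin (s + 1)))
    (y : EuclideanSpace ℝ (Fin n)) : EuclideanSpace ℝ (Fin (s + 1)) :=
  gradient (fun ψ' => M.logLik β ψ' y) ψ

/-- The Fisher information for `ψ`: the covariance matrix of the score for `ψ` under the model. -/
noncomputable def infoPsi (β : EuclideanSpace ℝ (Fin p)) (ψ : EuclideanSpace ℝ (Fin (s + 1))) :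
    Matrix (Fin (s + 1)) (Fin (s + 1)) ℝ :=
  Matrix.of fun i j =>
    covariance (fun y => M.scorePsi β ψ y i) (fun y => M.scorePsi β ψ y j) (M.law β ψ)

/-- The standardized score `W^S(ψ) = I(ψ)^{-1/2} S(ψ; β)` for `ψ` with known `β`. -/
noncomputable def stdScorePsi (β : EuclideanSpace ℝ (Fin p)) (ψ : EuclideanSpace ℝ (Fin (s + 1)))
    (y : EuclideanSpace ℝ (Fin n)) : EuclideanSpace ℝ (Fin (s + 1)) :=
  Matrix.toEuclideanCLM (n := Fin (s + 1)) (𝕜 := ℝ) (matInvSqrt (M.infoPsi β ψ)) (M.scorePsi β ψ y)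

/-! ### Inference on the full parameter `θ = (β, ψ) ∈ ℝ^{p + r}`

`ℝ^{p + r}` is indexed by `Fin p ⊕ Fin r`. -/

/-- The `β`-part of `θ`. -/
def betaPart (θ : EuclideanSpace ℝ (Fin p ⊕ Fin (s + 1))) : EuclideanSpace ℝ (Fin p) :=
  WithLp.toLp 2 fun i => θ (Sum.inl i)

/-- The `ψ`-part of `θ`. -/
def psiPart (θ : EuclideanSpace ℝ (Fin p ⊕ Fin (s + 1))) : EuclideanSpace ℝ (Fin (s + 1)) :=
  WithLp.toLp 2 fun j => θ (Sum.inr j)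

/-- The full score `S(θ) = ∂ℓ(θ)/∂θ ∈ ℝ^{p + r}`, at the data `y`. -/
noncomputable def score (θ : EuclideanSpace ℝ (Fin p ⊕ Fin (s + 1)))
    (y : EuclideanSpace ℝ (Fin n)) : EuclideanSpace ℝ (Fin p ⊕ Fin (s + 1)) :=
  gradient (fun θ' => M.logLik (betaPart θ') (psiPart θ') y) θ

/-- The Fisher information `I(θ) = cov_θ {S(θ)}`. -/
noncomputable def info (θ : EuclideanSpace ℝ (Fin p ⊕ Fin (s + 1))) :
    Matrix (Fin p ⊕ Fin (s + 1)) (Fin p ⊕ Fin (s + 1)) ℝ :=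
  Matrix.of fun i j =>
    covariance (fun y => M.score θ y i) (fun y => M.score θ y j)
      (M.law (betaPart θ) (psiPart θ))

/-- The standardized score `W^S(θ) = I(θ)^{-1/2} S(θ)`. -/
noncomputable def stdScore (θ : EuclideanSpace ℝ (Fin p ⊕ Fin (s + 1)))
    (y : EuclideanSpace ℝ (Fin n)) : EuclideanSpace ℝ (Fin p ⊕ Fin (s + 1)) :=
  Matrix.toEuclideanCLM (n := Fin p ⊕ Fin (s + 1)) (𝕜 := ℝ) (matInvSqrt (M.info θ)) (M.score θ y)

end MixedModel

/-! Write `Y = Xβ + Σ^{1/2} x` with `x` standard normal. The score in a direction `h = (b, v)` is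
then `cᵀ x + (xᵀ A x - tr A) / 2` with `c = Σ^{-1/2} X b` and `A = A(v, ψ)`; for known `β` the
linear term is absent (`inner_score_response`, `inner_scorePsi_response`). In an orthonormal
eigenbasis of `A` this is a sum of independent terms `c_i x_i + λ_i (x_i² - 1) / 2`, so its
variance, which is the quadratic form of the information at `h`, equals `‖c‖² + ‖A‖_F² / 2`.

For a unit vector `u`, the variable `uᵀ I^{-1/2} S` is the score in the direction `h = I^{-1/2} u`,
with variance exactly 1 (`exists_standardized_eq_gaussianQuadratic`). Hence `‖A‖_F` is bounded, and
`‖A‖ ≤ ā_n ‖A‖_F` tends to 0. The logarithm of the characteristic function of each independent term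
differs from that of a normal variable of equal variance by at most `2 |t λ_i|` times `t²` times the
variance. Summing, the exponent is within `2 |t| ‖A‖ t²` of `-t² / 2`
(`exists_charFun_map_gaussianQuadratic_eq_exp`). The bound involves no dimension and is uniform in
`h`, which is why the dimensions and `u` may vary freely with `n`.

The information is nonsingular once `ā_n < 1`: the value 1 assigned to `a` when `A` vanishes then
forces `A(v, ψ) ≠ 0` for every `v ≠ 0`. If `v = 0` and `b ≠ 0`, full column rank of `X` gives `c ≠
0`. -/

/-! ### Moments of a quadratic polynomial of one standard normal variable -/

theorem integral_pow_gaussianReal_zero_one :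
    ∫ x, x ^ 2 ∂gaussianReal 0 1 = 1 ∧ ∫ x, x ^ 3 ∂gaussianReal 0 1 = 0 ∧
      ∫ x, x ^ 4 ∂gaussianReal 0 1 = 3 := by
  have hmgf : mgf id (gaussianReal 0 1) = fun t : ℝ => Real.exp (t ^ 2 / 2) := by
    rw [mgf_id_gaussianReal]; ext t; simp
  have h0 : (0 : ℝ) ∈ interior (integrableExpSet id (gaussianReal 0 1)) := by
    simp [integrableExpSet_id_gaussianReal]
  -- Moments are read off as derivatives at 0 of the moment generating function `exp (t² / 2)`.
  have key (n : ℕ) : ∫ x, x ^ n ∂gaussianReal 0 1 =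
      iteratedDeriv n (fun t : ℝ => Real.exp (t ^ 2 / 2)) 0 := by
    rw [← hmgf, iteratedDeriv_mgf_zero h0]; rfl
  have hexp (t : ℝ) : HasDerivAt (fun t : ℝ => Real.exp (t ^ 2 / 2))
      (t * Real.exp (t ^ 2 / 2)) t := by
    have := ((hasDerivAt_pow 2 t).div_const 2).exp
    convert! this using 1
    simp; ring
  have h1 : deriv (fun t : ℝ => Real.exp (t ^ 2 / 2)) = fun t => t * Real.exp (t ^ 2 / 2) := by
    ext t; exact (hexp t).deriv
  have h2 : deriv (fun t : ℝ => t * Real.exp (t ^ 2 / 2)) =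
      fun t => (1 + t ^ 2) * Real.exp (t ^ 2 / 2) := by
    ext t
    rw [((hasDerivAt_id' t).fun_mul (hexp t)).deriv]; ring
  have h3 : deriv (fun t : ℝ => (1 + t ^ 2) * Real.exp (t ^ 2 / 2)) =
      fun t => (3 * t + t ^ 3) * Real.exp (t ^ 2 / 2) := by
    ext t
    rw [(((hasDerivAt_pow 2 t).const_add 1).fun_mul (hexp t)).deriv]; simp; ring
  have h4 : deriv (fun t : ℝ => (3 * t + t ^ 3) * Real.exp (t ^ 2 / 2)) =
      fun t => (3 + 6 * t ^ 2 + t ^ 4) * Real.exp (t ^ 2 / 2) := by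
    ext t
    rw [((((hasDerivAt_id' t).const_mul 3).fun_add (hasDerivAt_pow 3 t)).fun_mul (hexp t)).deriv]
    simp; ring
  refine ⟨?_, ?_, ?_⟩ <;> rw [key] <;>
    simp [iteratedDeriv_succ', h1, h2, h3, h4]

theorem memLp_linear_add_quadratic_gaussianReal (c l : ℝ) :
    MemLp (fun x : ℝ => c * x + l / 2 * (x ^ 2 - 1)) 2 (gaussianReal 0 1) := by
  have h2 : MemLp (fun x : ℝ => x ^ 2) 2 (gaussianReal 0 1) := by
    have h4 := memLp_id_gaussianReal' (μ := 0) (v := 1) 4 (by simp)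
    have : MemLp (fun x : ℝ => x * x) 2 (gaussianReal 0 1) :=
      MemLp.mul (p := 4) (q := 4) (r := 2) h4 h4 (hpqr := ⟨by
        rw [show (4 : ENNReal) = 2 * 2 by norm_num, ENNReal.mul_inv (by simp) (by simp), ← mul_add,
          ENNReal.inv_two_add_inv_two, mul_one]⟩)
    simpa [pow_two] using this
  have h1 := memLp_id_gaussianReal' (μ := 0) (v := 1) 2 (by simp)
  exact (h1.const_mul c).add ((h2.sub (memLp_const 1)).const_mul (l / 2))

theorem integral_linear_add_quadratic_gaussianReal (c l : ℝ) :
    ∫ x : ℝ, c * x + l / 2 * (x ^ 2 - 1) ∂gaussianReal 0 1 = 0 := by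
  have hi (n : ℕ) : Integrable (fun x : ℝ => x ^ n) (gaussianReal 0 1) := by
    have := memLp_id_gaussianReal (μ := 0) (v := 1) n
    simpa using this.integrable_norm_pow' |>.mono' (by fun_prop) (by simp)
  have e : ∀ x : ℝ, c * x + l / 2 * (x ^ 2 - 1) = c * x ^ 1 + l / 2 * x ^ 2 - l / 2 := by
    intro x; ring
  simp_rw [e]
  have i12 : Integrable (fun x : ℝ => c * x ^ 1 + l / 2 * x ^ 2) (gaussianReal 0 1) :=
    ((hi 1).const_mul c).add ((hi 2).const_mul _)
  rw [integral_sub i12 (integrable_const _),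
    integral_add ((hi 1).const_mul c) ((hi 2).const_mul _)]
  rw [integral_const_mul, integral_const_mul, integral_pow_gaussianReal_zero_one.1]
  simp

theorem variance_linear_add_quadratic_gaussianReal (c l : ℝ) :
    Var[fun x : ℝ => c * x + l / 2 * (x ^ 2 - 1); gaussianReal 0 1] = c ^ 2 + l ^ 2 / 2 := by
  have hi (n : ℕ) : Integrable (fun x : ℝ => x ^ n) (gaussianReal 0 1) := by
    have := memLp_id_gaussianReal (μ := 0) (v := 1) n
    simpa using this.integrable_norm_pow' |>.mono' (by fun_prop) (by simp)
  rw [variance_of_integral_eq_zero (by fun_prop) (integral_linear_add_quadratic_gaussianReal c l)]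
  have e : ∀ x : ℝ, (c * x + l / 2 * (x ^ 2 - 1)) ^ 2 =
      l ^ 2 / 4 * x ^ 4 + (c * l * x ^ 3 + ((c ^ 2 - l ^ 2 / 2) * x ^ 2 +
        (- (c * l) * x ^ 1 + l ^ 2 / 4))) := by
    intro x; ring
  simp only [e]
  obtain ⟨m2, m3, m4⟩ := integral_pow_gaussianReal_zero_one
  have i0 : Integrable (fun _ : ℝ => l ^ 2 / 4) (gaussianReal 0 1) := integrable_const _
  have i1 : Integrable (fun x : ℝ => -(c * l) * x ^ 1 + l ^ 2 / 4) (gaussianReal 0 1) :=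
    ((hi 1).const_mul _).add i0
  have i2 : Integrable (fun x : ℝ => (c ^ 2 - l ^ 2 / 2) * x ^ 2 +
      (-(c * l) * x ^ 1 + l ^ 2 / 4)) (gaussianReal 0 1) := ((hi 2).const_mul _).add i1
  have i3 : Integrable (fun x : ℝ => c * l * x ^ 3 + ((c ^ 2 - l ^ 2 / 2) * x ^ 2 +
      (-(c * l) * x ^ 1 + l ^ 2 / 4))) (gaussianReal 0 1) := ((hi 3).const_mul _).add i2
  rw [integral_add ((hi 4).const_mul _) i3, integral_add ((hi 3).const_mul _) i2,
    integral_add ((hi 2).const_mul _) i1, integral_add ((hi 1).const_mul _) i0]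
  simp only [integral_const_mul, m2, m3, m4]
  simp
  ring

/-! ### Characteristic function in one dimension -/

/-- The logarithm of the characteristic function at `t` of `c x + (l / 2) (x ^ 2 - 1)` for a
standard normal `x`. -/
noncomputable def gaussianQuadraticLogCharFun (c l t : ℝ) : ℂ :=
  -(1 / 2) * Complex.log (1 - t * l * Complex.I) - t * l * Complex.I / 2 -
    t ^ 2 * c ^ 2 / (2 * (1 - t * l * Complex.I))

/-- Multiplying by the density leaves the exponential of a quadratic with leading coefficient `-w /
2`, where `w = 1 - i t l`. As `Re w = 1`, the complex Gaussian integral converges for all `t`. -/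
theorem integral_cexp_linear_add_quadratic_gaussianReal (c l t : ℝ) :
    ∫ x : ℝ, Complex.exp (t * (c * x + l / 2 * (x ^ 2 - 1) : ℝ) * Complex.I) ∂gaussianReal 0 1 =
      Complex.exp (gaussianQuadraticLogCharFun c l t) := by
  set w : ℂ := 1 - t * l * Complex.I with hw
  have hwre : w.re = 1 := by simp [hw]
  have hw0 : w ≠ 0 := fun h => by simp [h] at hwre
  rw [integral_gaussianReal_eq_integral_smul one_ne_zero]
  have e (x : ℝ) : gaussianPDFReal 0 1 x •
      Complex.exp (t * (c * x + l / 2 * (x ^ 2 - 1) : ℝ) * Complex.I) =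
      ((√(2 * Real.pi))⁻¹ : ℝ) * Complex.exp (-(w / 2) * x ^ 2 + (t * c * Complex.I) * x +
        (-(t * l * Complex.I / 2))) := by
    simp only [gaussianPDFReal, Complex.real_smul, NNReal.coe_one, mul_one, sub_zero]
    push_cast
    rw [mul_assoc, ← Complex.exp_add]
    congr 2
    rw [hw]; ring
  simp_rw [e]
  rw [integral_const_mul, integral_cexp_quadratic (by simp [hwre])]
  have hpow : (Real.pi / - -(w / 2) : ℂ) ^ (1 / 2 : ℂ) =
      (√(2 * Real.pi) : ℝ) * Complex.exp (-(1 / 2) * Complex.log w) := by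
    have h1 : (Real.pi / - -(w / 2) : ℂ) = ((2 * Real.pi : ℝ) : ℂ) * w⁻¹ := by
      push_cast; field_simp
    -- With `Re w = 1` the point `w` avoids the branch cut, so `log w⁻¹ = -log w` holds for the
    -- principal logarithm.
    have harg : w.arg ≠ Real.pi := by
      rw [Ne, Complex.arg_eq_pi_iff, hwre]
      exact fun h => absurd h.1 (by norm_num)
    have hs : (√(2 * Real.pi) : ℝ) = Real.exp (1 / 2 * Real.log (2 * Real.pi)) := by
      rw [Real.sqrt_eq_rpow, Real.rpow_def_of_pos (by positivity), mul_comm]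
    rw [h1, Complex.cpow_def_of_ne_zero (mul_ne_zero (by
        exact_mod_cast (by positivity : (2 * Real.pi : ℝ) ≠ 0)) (inv_ne_zero hw0)),
      Complex.log_ofReal_mul (by positivity) (inv_ne_zero hw0), Complex.log_inv _ harg, hs,
      Complex.ofReal_exp, ← Complex.exp_add]
    congr 1
    push_cast
    ring
  rw [hpow, ← mul_assoc, ← mul_assoc, ← Complex.ofReal_mul, inv_mul_cancel₀ (by positivity),
    Complex.ofReal_one, one_mul, ← Complex.exp_add, gaussianQuadraticLogCharFun, ← hw]
  congr 1
  have hc : (t * c * Complex.I : ℂ) ^ 2 = -(t ^ 2 * c ^ 2) := by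
    rw [mul_pow, Complex.I_sq]; ring
  rw [hc]
  field_simp
  ring

/-- With `z = -i t l`, expand `log (1 + z)` to second order: the linear term cancels the centring
and the quadratic one supplies the variance `l² / 2`. What remains is a cubic remainder in `z` and
`(t² c² / 2) z / (1 + z)`. The bound is kept proportional to the variance so that it can be summed
over coordinates. -/
theorem norm_gaussianQuadraticLogCharFun_add_le {c l t : ℝ} (h : |t * l| ≤ 1 / 2) :
    ‖gaussianQuadraticLogCharFun c l t + ((t ^ 2 / 2 * (c ^ 2 + l ^ 2 / 2) : ℝ) : ℂ)‖ ≤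
      2 * |t * l| * (t ^ 2 * (c ^ 2 + l ^ 2 / 2)) := by
  set z : ℂ := -(t * l * Complex.I) with hz
  have hzn : ‖z‖ = |t * l| := by simp [hz, abs_mul]
  have hlog := Complex.norm_log_sub_logTaylor_le 2 (z := z) (by rw [hzn]; linarith)
  have htay : Complex.logTaylor (2 + 1) z = z - z ^ 2 / 2 := by
    simp [Complex.logTaylor_succ, Complex.logTaylor_zero]; ring
  rw [htay] at hlog
  have hinv : (1 - ‖z‖)⁻¹ ≤ 2 := by
    rw [inv_le_comm₀ (by rw [hzn]; linarith) two_pos, hzn]; linarith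
  have h1z : 1 / 2 ≤ ‖1 + z‖ := by
    have := norm_sub_norm_le (1 : ℂ) (-z)
    rw [norm_one, norm_neg, sub_neg_eq_add, hzn] at this
    linarith
  have h1z0 : 1 + z ≠ 0 := fun h0 => by rw [h0, norm_zero] at h1z; linarith
  have hz2 : z ^ 2 = -(t ^ 2 * l ^ 2) := by
    rw [hz]; ring_nf; simp
  have e : gaussianQuadraticLogCharFun c l t + ((t ^ 2 / 2 * (c ^ 2 + l ^ 2 / 2) : ℝ) : ℂ) =
      -(1 / 2) * (Complex.log (1 + z) - (z - z ^ 2 / 2)) +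
        ((t ^ 2 * c ^ 2 / 2 : ℝ) : ℂ) * (z / (1 + z)) := by
    have hz' : (t * l * Complex.I : ℂ) = -z := by rw [hz, neg_neg]
    rw [gaussianQuadraticLogCharFun, hz', sub_neg_eq_add]
    have e2 : z / (1 + z) = 1 - 1 / (1 + z) := by field_simp; ring
    rw [e2, hz2]
    push_cast
    field_simp
    ring
  rw [e]
  refine (norm_add_le _ _).trans ?_
  rw [norm_mul, norm_mul, norm_div, Complex.norm_real, Real.norm_of_nonneg (by positivity)]
  have b1 : ‖(-(1 / 2) : ℂ)‖ = 1 / 2 := by simp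
  rw [b1]
  have b2 : ‖z‖ / ‖1 + z‖ ≤ 2 * ‖z‖ := by
    rw [div_le_iff₀ (by linarith)]
    nlinarith [norm_nonneg z]
  have b3 : ‖Complex.log (1 + z) - (z - z ^ 2 / 2)‖ ≤ ‖z‖ ^ 3 := by
    refine hlog.trans ?_
    have : ‖z‖ ^ (2 + 1) * (1 - ‖z‖)⁻¹ ≤ ‖z‖ ^ 3 * 2 := by gcongr
    norm_num
    nlinarith [pow_nonneg (norm_nonneg z) 3]
  have b4 : ‖z‖ ^ 3 = |t * l| * (t ^ 2 * l ^ 2) := by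
    rw [hzn, pow_succ, sq_abs]; ring
  rw [b4] at b3
  rw [hzn] at b2
  rw [hzn]
  have b5 : t ^ 2 * c ^ 2 / 2 * (|t * l| / ‖1 + z‖) ≤ t ^ 2 * c ^ 2 / 2 * (2 * |t * l|) := by
    gcongr
  have : 0 ≤ |t * l| * (t ^ 2 * c ^ 2) := by positivity
  have : 0 ≤ |t * l| * (t ^ 2 * l ^ 2) := by positivity
  nlinarith

/-! ### Quadratic polynomials of a standard normal vector -/

section GaussianQuadratic

variable {ι : Type*} [Fintype ι] [DecidableEq ι]

/-- The centred quadratic polynomial `cᵀ x + (1 / 2) (xᵀ A x - tr A)`. -/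
noncomputable def gaussianQuadratic (c : EuclideanSpace ℝ ι) (A : Matrix ι ι ℝ)
    (x : EuclideanSpace ℝ ι) : ℝ :=
  inner ℝ c x + 1 / 2 * (inner ℝ x (Matrix.toEuclideanCLM (n := ι) (𝕜 := ℝ) A x) - A.trace)

theorem continuous_gaussianQuadratic (c : EuclideanSpace ℝ ι) (A : Matrix ι ι ℝ) :
    Continuous (gaussianQuadratic c A) := by
  unfold gaussianQuadratic
  fun_prop

theorem toEuclideanCLM_eigenvectorBasis {A : Matrix ι ι ℝ} (hA : A.IsHermitian) (i : ι) :
    Matrix.toEuclideanCLM (n := ι) (𝕜 := ℝ) A (hA.eigenvectorBasis i) =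
      hA.eigenvalues i • hA.eigenvectorBasis i := by
  ext j
  have := congrFun (hA.mulVec_eigenvectorBasis i) j
  simpa using this

/-- The eigenbasis of `A` decouples the polynomial. Since a standard normal vector has independent
standard normal coordinates in every orthonormal basis, variance and characteristic function reduce
to one dimension. -/
theorem gaussianQuadratic_sum_eigenvectorBasis (c : EuclideanSpace ℝ ι) {A : Matrix ι ι ℝ}
    (hA : A.IsHermitian) (x : ι → ℝ) :
    gaussianQuadratic c A (∑ i, x i • hA.eigenvectorBasis i) =
      ∑ i, (inner ℝ c (hA.eigenvectorBasis i) * x i +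
        hA.eigenvalues i / 2 * (x i ^ 2 - 1)) := by
  have h1 : inner ℝ (∑ i, x i • hA.eigenvectorBasis i)
      (Matrix.toEuclideanCLM (n := ι) (𝕜 := ℝ) A (∑ i, x i • hA.eigenvectorBasis i)) =
      ∑ i, hA.eigenvalues i * x i ^ 2 := by
    simp only [map_sum, map_smul, toEuclideanCLM_eigenvectorBasis, smul_smul]
    rw [hA.eigenvectorBasis.orthonormal.inner_sum]
    refine Finset.sum_congr rfl fun i _ => ?_
    simp; ring
  have h2 : A.trace = ∑ i, hA.eigenvalues i := by
    simpa using hA.trace_eq_sum_eigenvalues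
  rw [gaussianQuadratic, h1, h2, inner_sum, ← Finset.sum_sub_distrib, Finset.mul_sum,
    ← Finset.sum_add_distrib]
  refine Finset.sum_congr rfl fun i _ => ?_
  rw [real_inner_smul_right]; ring

/-- Both sides are `tr (A²)`. -/
theorem sum_eigenvalues_sq {A : Matrix ι ι ℝ} (hA : A.IsHermitian) :
    ∑ i, hA.eigenvalues i ^ 2 = ∑ i, ∑ j, A i j ^ 2 := by
  have h1 : (A * A).trace = ∑ i, hA.eigenvalues i ^ 2 := by
    conv_lhs => rw [hA.spectral_theorem]
    rw [← map_mul, Unitary.conjStarAlgAut_apply, Matrix.trace_mul_comm, ← mul_assoc]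
    simp [Matrix.diagonal_mul_diagonal, Matrix.trace_diagonal, pow_two]
  rw [← h1, Matrix.trace]
  refine Finset.sum_congr rfl fun i _ => ?_
  rw [Matrix.diag_apply, Matrix.mul_apply]
  refine Finset.sum_congr rfl fun j _ => ?_
  rw [pow_two]
  congr 1
  simpa using hA.apply i j

theorem sum_eigenvalues_sq_eq_matFrobeniusNorm_sq {A : Matrix ι ι ℝ} (hA : A.IsHermitian) :
    ∑ i, hA.eigenvalues i ^ 2 = matFrobeniusNorm A ^ 2 := by
  rw [sum_eigenvalues_sq, matFrobeniusNorm, Real.sq_sqrt (by positivity)]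

theorem abs_eigenvalues_le_matSpectralNorm {A : Matrix ι ι ℝ} (hA : A.IsHermitian) (i : ι) :
    |hA.eigenvalues i| ≤ matSpectralNorm A := by
  have h := (Matrix.toEuclideanCLM (n := ι) (𝕜 := ℝ) A).le_opNorm (hA.eigenvectorBasis i)
  rw [toEuclideanCLM_eigenvectorBasis, norm_smul, hA.eigenvectorBasis.orthonormal.1 i, mul_one,
    mul_one, Real.norm_eq_abs] at h
  exact h

theorem sum_inner_eigenvectorBasis_sq_add (c : EuclideanSpace ℝ ι) {A : Matrix ι ι ℝ}
    (hA : A.IsHermitian) :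
    ∑ i, (inner ℝ c (hA.eigenvectorBasis i) ^ 2 + hA.eigenvalues i ^ 2 / 2) =
      ‖c‖ ^ 2 + matFrobeniusNorm A ^ 2 / 2 := by
  rw [Finset.sum_add_distrib, ← Finset.sum_div, sum_eigenvalues_sq_eq_matFrobeniusNorm_sq,
    hA.eigenvectorBasis.sum_sq_inner_left]

theorem measurable_sum_smul_eigenvectorBasis {A : Matrix ι ι ℝ} (hA : A.IsHermitian) :
    Measurable fun x : ι → ℝ => ∑ i, x i • hA.eigenvectorBasis i := by fun_prop

theorem memLp_gaussianQuadratic (c : EuclideanSpace ℝ ι) {A : Matrix ι ι ℝ}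
    (hA : A.IsHermitian) :
    MemLp (gaussianQuadratic c A) 2 (stdGaussian (EuclideanSpace ℝ ι)) := by
  rw [stdGaussian_eq_map_pi_orthonormalBasis hA.eigenvectorBasis,
    memLp_map_measure_iff (continuous_gaussianQuadratic c A).aestronglyMeasurable
      (measurable_sum_smul_eigenvectorBasis hA).aemeasurable]
  have : gaussianQuadratic c A ∘ (fun x : ι → ℝ => ∑ i, x i • hA.eigenvectorBasis i) =
      fun x => ∑ i, (inner ℝ c (hA.eigenvectorBasis i) * x i +
        hA.eigenvalues i / 2 * (x i ^ 2 - 1)) :=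
    funext fun x => gaussianQuadratic_sum_eigenvectorBasis c hA x
  rw [this]
  refine memLp_finsetSum _ fun i _ => ?_
  exact (memLp_linear_add_quadratic_gaussianReal (inner ℝ c (hA.eigenvectorBasis i))
    (hA.eigenvalues i)).comp_measurePreserving
      (measurePreserving_eval (fun _ : ι => gaussianReal 0 1) i)

theorem variance_gaussianQuadratic (c : EuclideanSpace ℝ ι) {A : Matrix ι ι ℝ}
    (hA : A.IsHermitian) :
    Var[gaussianQuadratic c A; stdGaussian (EuclideanSpace ℝ ι)] =
      ‖c‖ ^ 2 + matFrobeniusNorm A ^ 2 / 2 := by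
  rw [stdGaussian_eq_map_pi_orthonormalBasis hA.eigenvectorBasis,
    variance_map (continuous_gaussianQuadratic c A).aemeasurable
      (measurable_sum_smul_eigenvectorBasis hA).aemeasurable]
  have : gaussianQuadratic c A ∘ (fun x : ι → ℝ => ∑ i, x i • hA.eigenvectorBasis i) =
      ∑ i, fun x : ι → ℝ => (fun y : ℝ => inner ℝ c (hA.eigenvectorBasis i) * y +
        hA.eigenvalues i / 2 * (y ^ 2 - 1)) (x i) := by
    funext x
    rw [Finset.sum_apply]
    exact gaussianQuadratic_sum_eigenvectorBasis c hA x
  rw [this, variance_sum_pi fun i => memLp_linear_add_quadratic_gaussianReal _ _]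
  simp_rw [variance_linear_add_quadratic_gaussianReal]
  exact sum_inner_eigenvectorBasis_sq_add c hA

theorem charFun_map_gaussianQuadratic (c : EuclideanSpace ℝ ι) {A : Matrix ι ι ℝ}
    (hA : A.IsHermitian) (t : ℝ) :
    charFun ((stdGaussian (EuclideanSpace ℝ ι)).map (gaussianQuadratic c A)) t =
      Complex.exp (∑ i, gaussianQuadraticLogCharFun (inner ℝ c (hA.eigenvectorBasis i))
        (hA.eigenvalues i) t) := by
  rw [charFun_apply_real, integral_map (continuous_gaussianQuadratic c A).aemeasurable
      (Measurable.aestronglyMeasurable (by fun_prop)),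
    stdGaussian_eq_map_pi_orthonormalBasis hA.eigenvectorBasis,
    integral_map (measurable_sum_smul_eigenvectorBasis hA).aemeasurable
      (Continuous.aestronglyMeasurable (by have := continuous_gaussianQuadratic c A; fun_prop))]
  simp_rw [gaussianQuadratic_sum_eigenvectorBasis, Complex.ofReal_sum, Finset.mul_sum,
    Finset.sum_mul, Complex.exp_sum]
  rw [integral_fintype_prod_eq_prod (f := fun i (x : ℝ) => Complex.exp
    (t * (inner ℝ c (hA.eigenvectorBasis i) * x +
      hA.eigenvalues i / 2 * (x ^ 2 - 1) : ℝ) * Complex.I))]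
  simp_rw [integral_cexp_linear_add_quadratic_gaussianReal]

/-- The characteristic function of a centred quadratic polynomial of a standard normal vector is
close to that of a normal variable with the same variance when the spectral norm is small. -/
theorem exists_charFun_map_gaussianQuadratic_eq_exp (c : EuclideanSpace ℝ ι) {A : Matrix ι ι ℝ}
    (hA : A.IsHermitian) {t : ℝ} (ht : |t| * matSpectralNorm A ≤ 1 / 2) :
    ∃ z : ℂ, charFun ((stdGaussian (EuclideanSpace ℝ ι)).map (gaussianQuadratic c A)) t =
        Complex.exp z ∧
      ‖z + ((t ^ 2 / 2 * (‖c‖ ^ 2 + matFrobeniusNorm A ^ 2 / 2) : ℝ) : ℂ)‖ ≤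
        2 * (|t| * matSpectralNorm A) * (t ^ 2 * (‖c‖ ^ 2 + matFrobeniusNorm A ^ 2 / 2)) := by
  refine ⟨_, charFun_map_gaussianQuadratic c hA t, ?_⟩
  have hl (i : ι) : |t * hA.eigenvalues i| ≤ |t| * matSpectralNorm A := by
    rw [abs_mul]
    exact mul_le_mul_of_nonneg_left (abs_eigenvalues_le_matSpectralNorm hA i) (abs_nonneg t)
  rw [← sum_inner_eigenvectorBasis_sq_add c hA, Finset.mul_sum, Complex.ofReal_sum,
    ← Finset.sum_add_distrib, Finset.mul_sum, Finset.mul_sum]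
  refine norm_sum_le_of_le _ fun i _ => ?_
  refine (norm_gaussianQuadraticLogCharFun_add_le ((hl i).trans ht)).trans ?_
  gcongr
  exact hl i

end GaussianQuadratic

/-! ### Square roots of positive definite matrices -/

section InvSqrt

variable {ι : Type*} [Fintype ι] [DecidableEq ι]

theorem isHermitian_matInvSqrt (M : Matrix ι ι ℝ) : (matInvSqrt M).IsHermitian :=
  IsSelfAdjoint.cfc

theorem Matrix.PosDef.pos_of_mem_spectrum {M : Matrix ι ι ℝ} (hM : M.PosDef) {x : ℝ}
    (hx : x ∈ spectrum ℝ M) : 0 < x := by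
  rw [hM.isHermitian.spectrum_real_eq_range_eigenvalues] at hx
  obtain ⟨i, rfl⟩ := hx
  exact hM.eigenvalues_pos i

/-- The spectrum is finite, so the continuity conditions of the functional calculus are vacuous and
identities between functions of `M` need only be checked at its eigenvalues. -/
theorem continuousOn_real_spectrum (M : Matrix ι ι ℝ) (f : ℝ → ℝ) :
    ContinuousOn f (spectrum ℝ M) :=
  Matrix.finite_real_spectrum.continuousOn f

theorem matInvSqrt_mul_mul_matInvSqrt {M : Matrix ι ι ℝ} (hM : M.PosDef) :
    matInvSqrt M * M * matInvSqrt M = 1 := by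
  have hsa : IsSelfAdjoint M := hM.isHermitian
  have hid : M = cfc (fun x : ℝ => x) M := (cfc_id' ℝ M).symm
  conv_lhs => rw [matInvSqrt]; enter [1, 2]; rw [hid]
  rw [← cfc_mul _ _ M (continuousOn_real_spectrum M _) (continuousOn_real_spectrum M _),
    ← cfc_mul _ _ M (continuousOn_real_spectrum M _) (continuousOn_real_spectrum M _),
    ← cfc_one ℝ M]
  refine cfc_congr fun x hx => ?_
  have hx0 := hM.pos_of_mem_spectrum hx
  have hs : √x ≠ 0 := (Real.sqrt_pos.2 hx0).ne'
  have := Real.mul_self_sqrt hx0.le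
  simp only [Pi.one_apply]
  field_simp
  rw [pow_two, this]

-- Links the root `CFC.sqrt`, through which the multivariate Gaussian law is built, to the inverse
-- root used for standardization.
open scoped MatrixOrder in
theorem sqrt_mul_matInvSqrt {M : Matrix ι ι ℝ} (hM : M.PosDef) :
    CFC.sqrt M * matInvSqrt M = 1 := by
  have hsa : IsSelfAdjoint M := hM.isHermitian
  rw [CFC.sqrt_eq_real_sqrt M hM.posSemidef.nonneg,
    cfcₙ_eq_cfc (hf := Real.continuous_sqrt.continuousOn) (hf0 := Real.sqrt_zero), matInvSqrt,
    ← cfc_mul _ _ M (continuousOn_real_spectrum M _) (continuousOn_real_spectrum M _),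
    ← cfc_one ℝ M]
  refine cfc_congr fun x hx => ?_
  exact mul_inv_cancel₀ (Real.sqrt_pos.2 (hM.pos_of_mem_spectrum hx)).ne'

open scoped MatrixOrder in
theorem isHermitian_sqrt (M : Matrix ι ι ℝ) : (CFC.sqrt M).IsHermitian :=
  (CFC.sqrt_nonneg M).isSelfAdjoint

theorem inner_toEuclideanCLM_comm {M : Matrix ι ι ℝ} (hM : M.IsHermitian)
    (x y : EuclideanSpace ℝ ι) :
    inner ℝ x (Matrix.toEuclideanCLM (n := ι) (𝕜 := ℝ) M y) =
      inner ℝ (Matrix.toEuclideanCLM (n := ι) (𝕜 := ℝ) M x) y := by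
  have hMt : Mᵀ = M := by rw [← Matrix.conjTranspose_eq_transpose_of_trivial]; exact hM.eq
  rw [Matrix.inner_toEuclideanCLM, real_inner_comm, Matrix.inner_toEuclideanCLM,
    Matrix.dotProduct_mulVec, ← Matrix.mulVec_transpose, hMt, dotProduct_comm]

end InvSqrt

/-! ### Covariance matrices and standardization of a score -/

section CovMatrix

variable {Ω κ : Type*} [MeasurableSpace Ω]

/-- The covariance matrix of the random vector `S` under `μ`. -/
noncomputable def covMatrix (S : Ω → EuclideanSpace ℝ κ) (μ : Measure Ω) : Matrix κ κ ℝ :=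
  Matrix.of fun i j => covariance (fun y => S y i) (fun y => S y j) μ

theorem isHermitian_covMatrix (S : Ω → EuclideanSpace ℝ κ) (μ : Measure Ω) :
    (covMatrix S μ).IsHermitian := by
  ext i j
  simp [covMatrix, covariance_comm]

end CovMatrix

section Score

variable {ι κ : Type*} [Fintype ι] [DecidableEq ι] [Fintype κ] [DecidableEq κ]
  {S : EuclideanSpace ℝ ι → EuclideanSpace ℝ κ} {T : EuclideanSpace ℝ ι → EuclideanSpace ℝ ι}
  {c : EuclideanSpace ℝ κ → EuclideanSpace ℝ ι} {A : EuclideanSpace ℝ κ → Matrix ι ι ℝ}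

/-- The quadratic form of a covariance matrix at `h` is the variance of the linear functional `h` of
the vector. By hypothesis that functional is a Gaussian quadratic polynomial, whose variance is
known. -/
theorem dotProduct_covMatrix_mulVec (hSm : Measurable S) (hT : Measurable T)
    (hA : ∀ h, (A h).IsHermitian)
    (hS : ∀ h x, inner ℝ h (S (T x)) = gaussianQuadratic (c h) (A h) x)
    (h : EuclideanSpace ℝ κ) :
    h.ofLp ⬝ᵥ covMatrix S ((stdGaussian (EuclideanSpace ℝ ι)).map T) *ᵥ h.ofLp =
      ‖c h‖ ^ 2 + matFrobeniusNorm (A h) ^ 2 / 2 := by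
  have hcoord (i : κ) : (fun x => S (T x) i) =
      gaussianQuadratic (c (EuclideanSpace.single i 1)) (A (EuclideanSpace.single i 1)) := by
    funext x
    rw [← hS]
    simp [EuclideanSpace.inner_single_left]
  have hmem (i : κ) : MemLp (fun x => h i * S (T x) i) 2 (stdGaussian (EuclideanSpace ℝ ι)) := by
    have := memLp_gaussianQuadratic (c (EuclideanSpace.single i 1)) (hA (EuclideanSpace.single i 1))
    rw [← hcoord] at this
    exact this.const_mul _
  have hmeas (i : κ) : Measurable fun y => S y i := by fun_prop
  have hsum : (fun x => ∑ i, h i * S (T x) i) = gaussianQuadratic (c h) (A h) := by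
    funext x
    rw [← hS, EuclideanSpace.inner_eq_star_dotProduct]
    simp [dotProduct, mul_comm]
  rw [← variance_gaussianQuadratic (c h) (hA h), ← hsum,
    ← covariance_self (by rw [hsum]; exact (continuous_gaussianQuadratic _ _).aemeasurable),
    covariance_fun_sum_fun_sum hmem hmem, dotProduct]
  refine Finset.sum_congr rfl fun i _ => ?_
  rw [Matrix.mulVec, dotProduct, Finset.mul_sum]
  refine Finset.sum_congr rfl fun j _ => ?_
  rw [covariance_const_mul_left, covariance_const_mul_right, covMatrix, Matrix.of_apply,
    covariance_map_fun (hmeas i).aestronglyMeasurable (hmeas j).aestronglyMeasurable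
      hT.aemeasurable]
  ring

theorem posDef_covMatrix (hSm : Measurable S) (hT : Measurable T)
    (hA : ∀ h, (A h).IsHermitian)
    (hS : ∀ h x, inner ℝ h (S (T x)) = gaussianQuadratic (c h) (A h) x)
    (hpos : ∀ h, h ≠ 0 → 0 < ‖c h‖ ^ 2 + matFrobeniusNorm (A h) ^ 2 / 2) :
    (covMatrix S ((stdGaussian (EuclideanSpace ℝ ι)).map T)).PosDef := by
  refine Matrix.PosDef.of_dotProduct_mulVec_pos (isHermitian_covMatrix _ _) fun x hx => ?_
  have := dotProduct_covMatrix_mulVec hSm hT hA hS (WithLp.toLp 2 x)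
  rw [star_trivial]
  change x ⬝ᵥ _ *ᵥ x = _ at this
  rw [this]
  exact hpos _ (by simpa using hx)

theorem exists_standardized_eq_gaussianQuadratic (hSm : Measurable S) (hT : Measurable T)
    (hA : ∀ h, (A h).IsHermitian)
    (hS : ∀ h x, inner ℝ h (S (T x)) = gaussianQuadratic (c h) (A h) x)
    (hI : (covMatrix S ((stdGaussian (EuclideanSpace ℝ ι)).map T)).PosDef)
    {u : EuclideanSpace ℝ κ} (hu : ‖u‖ = 1) :
    ∃ h, ‖c h‖ ^ 2 + matFrobeniusNorm (A h) ^ 2 / 2 = 1 ∧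
      ∀ x, inner ℝ u (Matrix.toEuclideanCLM (n := κ) (𝕜 := ℝ)
        (matInvSqrt (covMatrix S ((stdGaussian (EuclideanSpace ℝ ι)).map T))) (S (T x))) =
          gaussianQuadratic (c h) (A h) x := by
  set I := covMatrix S ((stdGaussian (EuclideanSpace ℝ ι)).map T) with hIdef
  have hR := isHermitian_matInvSqrt I
  -- The direction is `h = I^{-1/2} u`: symmetry moves `I^{-1/2}` across the inner product, and the
  -- variance is `uᵀ I^{-1/2} I I^{-1/2} u = ‖u‖² = 1`.
  refine ⟨Matrix.toEuclideanCLM (n := κ) (𝕜 := ℝ) (matInvSqrt I) u, ?_, fun x => ?_⟩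
  · rw [← dotProduct_covMatrix_mulVec hSm hT hA hS, ← Matrix.inner_toEuclideanCLM, ← hIdef,
      ← inner_toEuclideanCLM_comm hR, ← mul_apply_eq_comp,
      ← mul_apply_eq_comp, ← map_mul, ← map_mul,
      matInvSqrt_mul_mul_matInvSqrt hI, map_one, one_apply_eq_self,
      real_inner_self_eq_norm_sq, hu, one_pow]
  · rw [inner_toEuclideanCLM_comm hR, hS]

end Score

/-! ### Convergence to the normal law through characteristic functions -/

section Limit

/-- Lévy's continuity theorem for sequences indexed by `ℕ`, transported along the order isomorphism
with `ℕ+`. -/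
theorem MeasureTheory.ProbabilityMeasure.tendsto_of_tendsto_charFun_pnat
    {μ : ℕ+ → ProbabilityMeasure ℝ} {μ₀ : ProbabilityMeasure ℝ}
    (h : ∀ t : ℝ, Tendsto (fun n => charFun (μ n : Measure ℝ) t) atTop
      (𝓝 (charFun (μ₀ : Measure ℝ) t))) :
    Tendsto μ atTop (𝓝 μ₀) := by
  have h1 : Tendsto (fun k : ℕ => μ (OrderIso.pnatIsoNat.symm k)) atTop (𝓝 μ₀) :=
    ProbabilityMeasure.tendsto_of_tendsto_charFun fun t =>
      (h t).comp OrderIso.pnatIsoNat.symm.tendsto_atTop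
  have h2 := h1.comp OrderIso.pnatIsoNat.tendsto_atTop
  refine h2.congr fun n => ?_
  simp

/-- A sequence of centred quadratic polynomials of standard normal vectors, normalized to unit
variance, is asymptotically standard normal when the spectral norms tend to zero. -/
theorem tendstoInDistribution_of_map_eq_gaussianQuadratic
    {Ω : ℕ+ → Type*} [∀ n, MeasurableSpace (Ω n)]
    {P : (n : ℕ+) → Measure (Ω n)} [∀ n, IsProbabilityMeasure (P n)]
    {W : (n : ℕ+) → Ω n → ℝ} (hW : ∀ n, AEMeasurable (W n) (P n)) {δ : ℕ+ → ℝ}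
    (hδ : Tendsto δ atTop (𝓝 0))
    (hQ : ∀ᶠ n : ℕ+ in atTop, ∃ (c : EuclideanSpace ℝ (Fin n)) (A : Matrix (Fin n) (Fin n) ℝ),
      A.IsHermitian ∧ ‖c‖ ^ 2 + matFrobeniusNorm A ^ 2 / 2 = 1 ∧ matSpectralNorm A ≤ δ n ∧
      (P n).map (W n) = (stdGaussian (EuclideanSpace ℝ (Fin n))).map (gaussianQuadratic c A)) :
    TendstoInDistribution W atTop (id : ℝ → ℝ) P (gaussianReal 0 1) := by
  refine ⟨hW, aemeasurable_id, ?_⟩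
  refine ProbabilityMeasure.tendsto_of_tendsto_charFun_pnat fun t => ?_
  simp only [ProbabilityMeasure.coe_mk, Measure.map_id, charFun_gaussianReal]
  have hlim : Complex.exp (t * (0 : ℝ) * Complex.I - (1 : NNReal) * t ^ 2 / 2) =
      Complex.exp (-((t ^ 2 / 2 : ℝ) : ℂ)) := by
    congr 1; push_cast; ring
  rw [hlim, Metric.tendsto_nhds]
  intro ε hε
  -- Continuity of `exp` at `-t² / 2` reduces the claim to closeness of the exponents.
  obtain ⟨η, hη, hexp⟩ := Metric.continuousAt_iff.1
    (Complex.continuous_exp.continuousAt (x := -((t ^ 2 / 2 : ℝ) : ℂ))) ε hε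
  have h1 : ∀ᶠ n in atTop, |t| * δ n < 1 / 2 := by
    have : Tendsto (fun n => |t| * δ n) atTop (𝓝 0) := by simpa using hδ.const_mul |t|
    exact this.eventually_lt_const (by norm_num)
  have h2 : ∀ᶠ n in atTop, 2 * (|t| * δ n) * t ^ 2 < η := by
    have : Tendsto (fun n => 2 * (|t| * δ n) * t ^ 2) atTop (𝓝 0) := by
      simpa using ((hδ.const_mul |t|).const_mul 2).mul_const (t ^ 2)
    exact this.eventually_lt_const hη
  filter_upwards [h1, h2, hQ] with n hn1 hn2 ⟨c, A, hA, hvar, hspec, hlaw⟩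
  have hle : |t| * matSpectralNorm A ≤ |t| * δ n := by gcongr
  obtain ⟨z, hz, hzle⟩ := exists_charFun_map_gaussianQuadratic_eq_exp c hA
    (t := t) (hle.trans hn1.le)
  rw [hlaw, hz]
  apply hexp
  rw [hvar, mul_one, mul_one] at hzle
  rw [dist_eq_norm, sub_neg_eq_add]
  refine hzle.trans_lt (lt_of_le_of_lt ?_ hn2)
  gcongr

end Limit

/-! ### Gradient of the Gaussian log-likelihood -/

section Derivative

variable {ι : Type*} [Fintype ι] [DecidableEq ι]

theorem differentiableAt_det {E : Type*} [NormedAddCommGroup E] [NormedSpace ℝ E]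
    {F : E → Matrix ι ι ℝ} {x : E} (hF : ∀ i j, DifferentiableAt ℝ (fun y => F y i j) x) :
    DifferentiableAt ℝ (fun y => (F y).det) x := by
  simp only [Matrix.det_apply']
  fun_prop

/-- By Cramer's rule the entries of the inverse are quotients of determinants. Working entrywise
avoids choosing a norm on matrices. -/
theorem differentiableAt_inv_apply {E : Type*} [NormedAddCommGroup E] [NormedSpace ℝ E]
    {F : E → Matrix ι ι ℝ} {x : E} (hF : ∀ i j, DifferentiableAt ℝ (fun y => F y i j) x)
    (hx : (F x).det ≠ 0) (i j : ι) : DifferentiableAt ℝ (fun y => (F y)⁻¹ i j) x := by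
  have h1 : DifferentiableAt ℝ (fun y => ((F y).updateRow j (Pi.single i 1)).det) x := by
    refine differentiableAt_det fun k l => ?_
    by_cases hk : k = j
    · subst hk; simp
    · simpa [Matrix.updateRow_ne hk] using hF k l
  simp only [Matrix.inv_def, Ring.inverse_eq_inv', Matrix.smul_apply, smul_eq_mul,
    Matrix.adjugate_apply]
  exact ((differentiableAt_det hF).inv hx).mul h1

/-- Differentiability being known, the value follows by differentiating `F F⁻¹ = 1`, valid near `t`
because the determinant stays nonzero there. -/
theorem hasDerivAt_inv_apply {F : ℝ → Matrix ι ι ℝ} {F' : Matrix ι ι ℝ} {t : ℝ}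
    (hF : ∀ i j, HasDerivAt (fun s => F s i j) (F' i j) t) (ht : (F t).det ≠ 0) (i j : ι) :
    HasDerivAt (fun s => (F s)⁻¹ i j) ((-((F t)⁻¹ * F' * (F t)⁻¹)) i j) t := by
  set D : Matrix ι ι ℝ := Matrix.of fun i j => deriv (fun s => (F s)⁻¹ i j) t with hD
  have hinv (i j : ι) : HasDerivAt (fun s => (F s)⁻¹ i j) (D i j) t :=
    (differentiableAt_inv_apply (fun i j => (hF i j).differentiableAt) ht i j).hasDerivAt
  have hev : ∀ᶠ s in 𝓝 t, (F s).det ≠ 0 :=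
    (differentiableAt_det fun i j => (hF i j).differentiableAt).continuousAt.eventually_ne ht
  have hunit : IsUnit (F t).det := isUnit_iff_ne_zero.2 ht
  have hzero : F' * (F t)⁻¹ + F t * D = 0 := by
    ext i j
    have h1 : HasDerivAt (fun s => (F s * (F s)⁻¹) i j) ((F' * (F t)⁻¹ + F t * D) i j) t := by
      simp only [Matrix.add_apply, Matrix.mul_apply, ← Finset.sum_add_distrib]
      exact HasDerivAt.fun_sum fun k _ => (hF i k).fun_mul (hinv k j)
    have h2 : HasDerivAt (fun s => (F s * (F s)⁻¹) i j) 0 t := by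
      refine (hasDerivAt_const t ((1 : Matrix ι ι ℝ) i j)).congr_of_eventuallyEq ?_
      filter_upwards [hev] with s hs
      rw [Matrix.mul_nonsing_inv _ (isUnit_iff_ne_zero.2 hs)]
    exact h1.unique h2
  have hDeq : D = -((F t)⁻¹ * F' * (F t)⁻¹) := by
    have := congrArg (fun N => (F t)⁻¹ * N) hzero
    simp only [mul_add, mul_zero, ← mul_assoc, Matrix.nonsing_inv_mul _ hunit, one_mul] at this
    exact eq_neg_of_add_eq_zero_right this
  rw [← hDeq]
  exact hinv i j

/-- Factor out `P` and use that `det (1 + t N) - 1 - t tr N` is `t²` times a polynomial in `t`,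
hence has zero derivative at 0. -/
theorem hasDerivAt_log_det_add_smul {P : Matrix ι ι ℝ} (hP : P.det ≠ 0) (B : Matrix ι ι ℝ) :
    HasDerivAt (fun t : ℝ => Real.log (P + t • B).det) (P⁻¹ * B).trace 0 := by
  have hdet (t : ℝ) : (P + t • B).det = P.det * (1 + (P⁻¹ * B).trace * t +
      (Matrix.det (1 + (Polynomial.X : Polynomial ℝ) •
        (P⁻¹ * B).map Polynomial.C)).divX.divX.eval t * t ^ 2) := by
    rw [← Matrix.det_one_add_smul, ← Matrix.det_mul, mul_add, mul_one, mul_smul_comm,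
      ← mul_assoc, Matrix.mul_nonsing_inv _ (isUnit_iff_ne_zero.2 hP), one_mul]
  have h1 : HasDerivAt (fun t : ℝ => (P + t • B).det) (P.det * (P⁻¹ * B).trace) 0 := by
    simp only [hdet]
    have hq := ((Matrix.det (1 + (Polynomial.X : Polynomial ℝ) •
        (P⁻¹ * B).map Polynomial.C)).divX.divX.hasDerivAt 0).fun_mul (hasDerivAt_pow 2 (0 : ℝ))
    have := (((((hasDerivAt_id' (0 : ℝ)).const_mul (P⁻¹ * B).trace).const_add 1).fun_add
      hq).const_mul P.det)
    convert! this using 1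
    simp
  have h2 := h1.log (by simpa using hP)
  convert! h2 using 1
  simp only [zero_smul, add_zero]
  field_simp

variable {E : Type*} [NormedAddCommGroup E] [InnerProductSpace ℝ E] [FiniteDimensional ℝ E]
  [CompleteSpace E]

/-- The gradient of a Gaussian log-likelihood whose mean and covariance matrix depend linearly on
the parameter. -/
theorem inner_gradient_gaussianLogLik (B : E →ₗ[ℝ] Matrix ι ι ℝ) (m : E →ₗ[ℝ] (ι → ℝ))
    (y : ι → ℝ) {θ : E} (hP : (B θ).PosDef) (h : E) :
    inner ℝ h (gradient (fun θ' => -(1 / 2) * (Real.log (B θ').det +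
        (y - m θ') ⬝ᵥ ((B θ')⁻¹ *ᵥ (y - m θ')))) θ) =
      m h ⬝ᵥ ((B θ)⁻¹ *ᵥ (y - m θ)) +
        1 / 2 * ((y - m θ) ⬝ᵥ (((B θ)⁻¹ * B h * (B θ)⁻¹) *ᵥ (y - m θ)) -
          ((B θ)⁻¹ * B h).trace) := by
  have hdet : (B θ).det ≠ 0 := hP.det_pos.ne'
  have hB (i j : ι) : DifferentiableAt ℝ (fun θ' => B θ' i j) θ :=
    ((Matrix.entryLinearMap ℝ ℝ i j ∘ₗ B).toContinuousLinearMap).differentiableAt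
  have hm (i : ι) : DifferentiableAt ℝ (fun θ' => m θ' i) θ :=
    ((LinearMap.proj i ∘ₗ m).toContinuousLinearMap).differentiableAt
  have hinv (i j : ι) : DifferentiableAt ℝ (fun θ' => (B θ')⁻¹ i j) θ :=
    differentiableAt_inv_apply hB hdet i j
  have hdiff : DifferentiableAt ℝ (fun θ' => -(1 / 2) * (Real.log (B θ').det +
        (y - m θ') ⬝ᵥ ((B θ')⁻¹ *ᵥ (y - m θ')))) θ := by
    have h1 := (differentiableAt_det hB).log hdet
    have h2 : DifferentiableAt ℝ (fun θ' => (y - m θ') ⬝ᵥ ((B θ')⁻¹ *ᵥ (y - m θ'))) θ := by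
      simp only [dotProduct, Matrix.mulVec, Pi.sub_apply]
      exact DifferentiableAt.fun_sum fun i _ => ((hm i).const_sub (y i)).fun_mul
        (DifferentiableAt.fun_sum fun j _ => (hinv i j).fun_mul ((hm j).const_sub (y j)))
    exact (h1.add h2).const_mul _
  -- Differentiability is settled, so the inner product of the gradient with `h` is the derivative
  -- at `t = 0` along the line `θ + t h`, on which mean and covariance are affine in `t`.
  have hline (t : ℝ) : B (θ + t • h) = B θ + t • B h := by rw [map_add, map_smul]
  have hF (i j : ι) : HasDerivAt (fun t : ℝ => B (θ + t • h) i j) (B h i j) 0 := by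
    simp only [hline, Matrix.add_apply, Matrix.smul_apply, smul_eq_mul]
    simpa using ((hasDerivAt_id' (0 : ℝ)).mul_const (B h i j)).const_add (B θ i j)
  have hFinv := hasDerivAt_inv_apply hF (by simpa using hdet)
  simp only [zero_smul, add_zero] at hFinv
  have hr (i : ι) : HasDerivAt (fun t : ℝ => y i - m (θ + t • h) i) (-m h i) 0 := by
    simp only [map_add, map_smul, Pi.add_apply, Pi.smul_apply, smul_eq_mul]
    simpa using (((hasDerivAt_id' (0 : ℝ)).mul_const (m h i)).const_add (m θ i)).const_sub (y i)
  have hq : HasDerivAt (fun t : ℝ => (y - m (θ + t • h)) ⬝ᵥ ((B (θ + t • h))⁻¹ *ᵥ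
      (y - m (θ + t • h)))) (-(m h ⬝ᵥ ((B θ)⁻¹ *ᵥ (y - m θ))) +
        ((y - m θ) ⬝ᵥ ((-((B θ)⁻¹ * B h * (B θ)⁻¹)) *ᵥ (y - m θ)) +
        (y - m θ) ⬝ᵥ ((B θ)⁻¹ *ᵥ (-m h)))) 0 := by
    have hmv (i : ι) : HasDerivAt (fun t : ℝ => ((B (θ + t • h))⁻¹ *ᵥ (y - m (θ + t • h))) i)
        (((-((B θ)⁻¹ * B h * (B θ)⁻¹)) *ᵥ (y - m θ)) i + ((B θ)⁻¹ *ᵥ (-m h)) i) 0 := by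
      simp only [Matrix.mulVec, dotProduct, ← Finset.sum_add_distrib]
      refine HasDerivAt.fun_sum fun j _ => ?_
      simpa using (hFinv i j).fun_mul (hr j)
    have := HasDerivAt.fun_sum fun i (_ : i ∈ Finset.univ) => (hr i).fun_mul (hmv i)
    simp only [zero_smul, add_zero] at this
    convert! this using 1
    simp only [dotProduct, ← Finset.sum_neg_distrib, ← Finset.sum_add_distrib]
    refine Finset.sum_congr rfl fun i _ => ?_
    simp only [Pi.sub_apply]
    ring
  have hlog := hasDerivAt_log_det_add_smul hdet (B h)
  simp only [← hline] at hlog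
  rw [real_inner_comm, inner_gradient_left, ← hdiff.lineDeriv_eq_fderiv, lineDeriv,
    ((hlog.fun_add hq).const_mul (-(1 / 2))).deriv]
  have hsymm : (y - m θ) ⬝ᵥ ((B θ)⁻¹ *ᵥ (-m h)) = -(m h ⬝ᵥ ((B θ)⁻¹ *ᵥ (y - m θ))) := by
    have ht : ((B θ)⁻¹)ᵀ = (B θ)⁻¹ := by
      rw [← Matrix.conjTranspose_eq_transpose_of_trivial]
      exact hP.isHermitian.inv.eq
    rw [Matrix.mulVec_neg, dotProduct_neg, Matrix.dotProduct_mulVec, ← Matrix.mulVec_transpose, ht,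
      dotProduct_comm]
  rw [hsymm, Matrix.neg_mulVec, dotProduct_neg]
  ring

end Derivative

/-! ### Measurability, scaling of the norms, and whitening -/

section EuclideanSpace

variable {ι : Type*} [Fintype ι]

/-- Serves for the score, whose explicit formula is available only through inner products with fixed
directions. -/
theorem measurable_of_measurable_inner {Ω : Type*} [MeasurableSpace Ω]
    {S : Ω → EuclideanSpace ℝ ι} (h : ∀ v, Measurable fun y => inner ℝ v (S y)) :
    Measurable S := by
  have : S = fun y => ∑ i, inner ℝ (EuclideanSpace.basisFun ι ℝ i) (S y) •
      EuclideanSpace.basisFun ι ℝ i :=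
    funext fun y => ((EuclideanSpace.basisFun ι ℝ).sum_repr' (S y)).symm
  rw [this]
  exact Finset.measurable_sum _ fun i _ => (h _).smul_const _

theorem matFrobeniusNorm_smul (t : ℝ) (M : Matrix ι ι ℝ) :
    matFrobeniusNorm (t • M) = |t| * matFrobeniusNorm M := by
  simp only [matFrobeniusNorm, Matrix.smul_apply, smul_eq_mul, mul_pow, ← Finset.mul_sum]
  rw [Real.sqrt_mul (sq_nonneg t), Real.sqrt_sq_eq_abs]

end EuclideanSpace

section Whitening

variable {ι : Type*} [Fintype ι] [DecidableEq ι]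

theorem inv_eq_matInvSqrt_mul_matInvSqrt {M : Matrix ι ι ℝ} (hM : M.PosDef) :
    M⁻¹ = matInvSqrt M * matInvSqrt M := by
  refine Matrix.inv_eq_left_inv ?_
  rw [mul_assoc]
  exact mul_eq_one_comm.1 (matInvSqrt_mul_mul_matInvSqrt hM)

-- Inserting the residual `M^{1/2} x` collapses `M^{1/2} M⁻¹ B M⁻¹ M^{1/2}` to `M^{-1/2} B
-- M^{-1/2}`, and cyclicity gives this matrix the trace of `M⁻¹ B`, so the score is centred exactly.
open scoped MatrixOrder in
theorem score_sqrt_mulVec_eq_gaussianQuadratic {M : Matrix ι ι ℝ} (hM : M.PosDef)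
    (B : Matrix ι ι ℝ) (b x : EuclideanSpace ℝ ι) :
    b.ofLp ⬝ᵥ (M⁻¹ *ᵥ (CFC.sqrt M *ᵥ x.ofLp)) +
        1 / 2 * ((CFC.sqrt M *ᵥ x.ofLp) ⬝ᵥ ((M⁻¹ * B * M⁻¹) *ᵥ (CFC.sqrt M *ᵥ x.ofLp)) -
          (M⁻¹ * B).trace) =
      gaussianQuadratic (Matrix.toEuclideanCLM (n := ι) (𝕜 := ℝ) (matInvSqrt M) b)
        (matInvSqrt M * B * matInvSqrt M) x := by
  have hRT : matInvSqrt M * CFC.sqrt M = 1 := mul_eq_one_comm.1 (sqrt_mul_matInvSqrt hM)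
  have hTR := sqrt_mul_matInvSqrt hM
  have hTt : (CFC.sqrt M)ᵀ = CFC.sqrt M := by
    rw [← Matrix.conjTranspose_eq_transpose_of_trivial]; exact (isHermitian_sqrt M).eq
  rw [gaussianQuadratic, ← inner_toEuclideanCLM_comm (isHermitian_matInvSqrt M),
    Matrix.inner_toEuclideanCLM, Matrix.inner_toEuclideanCLM,
    inv_eq_matInvSqrt_mul_matInvSqrt hM]
  have h1 : matInvSqrt M * matInvSqrt M * CFC.sqrt M = matInvSqrt M := by
    rw [mul_assoc, hRT, mul_one]
  have h2 : CFC.sqrt M * (matInvSqrt M * matInvSqrt M * B * (matInvSqrt M * matInvSqrt M)) *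
      CFC.sqrt M = matInvSqrt M * B * matInvSqrt M := by
    calc _ = (CFC.sqrt M * matInvSqrt M) * matInvSqrt M * B * matInvSqrt M *
          (matInvSqrt M * CFC.sqrt M) := by simp only [mul_assoc]
      _ = _ := by rw [hTR, hRT, one_mul, mul_one]
  have h3 : (matInvSqrt M * matInvSqrt M * B).trace = (matInvSqrt M * B * matInvSqrt M).trace := by
    rw [mul_assoc, Matrix.trace_mul_comm]
  have h4 (N : Matrix ι ι ℝ) : (CFC.sqrt M *ᵥ x.ofLp) ⬝ᵥ (N *ᵥ (CFC.sqrt M *ᵥ x.ofLp)) =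
      x.ofLp ⬝ᵥ ((CFC.sqrt M * N * CFC.sqrt M) *ᵥ x.ofLp) := by
    rw [← Matrix.mulVec_mulVec, ← Matrix.mulVec_mulVec, Matrix.dotProduct_mulVec x.ofLp,
      ← Matrix.mulVec_transpose, hTt]
  rw [h4, h2, h3, Matrix.mulVec_mulVec, h1]

theorem matSpectralNorm_smul (t : ℝ) (M : Matrix ι ι ℝ) :
    matSpectralNorm (t • M) = |t| * matSpectralNorm M := by
  rw [matSpectralNorm, map_smul, norm_smul, Real.norm_eq_abs, matSpectralNorm]

end Whitening

/-! ### The score of the mixed model as a Gaussian quadratic polynomial -/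

namespace MixedModel

variable {n p q s : ℕ} (M : MixedModel n p q s)

/-- `Σ(v)` as a linear map of `v`. -/
def sigmaLinearMap : EuclideanSpace ℝ (Fin (s + 1)) →ₗ[ℝ] Matrix (Fin n) (Fin n) ℝ where
  toFun := M.Sigma
  map_add' u v := by
    have : M.Psi (u + v) = M.Psi u + M.Psi v := by
      ext i j
      simp only [Psi, Matrix.of_apply, Matrix.add_apply]
      cases M.pattern i j <;> simp
    simp only [Sigma, this, Matrix.mul_add, Matrix.add_mul, PiLp.add_apply, add_smul]
    abel
  map_smul' t v := by
    have : M.Psi (t • v) = t • M.Psi v := by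
      ext i j
      simp only [Psi, Matrix.of_apply, Matrix.smul_apply]
      cases M.pattern i j <;> simp
    simp [Sigma, this, smul_smul]

theorem sigmaLinearMap_apply (v : EuclideanSpace ℝ (Fin (s + 1))) :
    M.sigmaLinearMap v = M.Sigma v := rfl

theorem isHermitian_Sigma (v : EuclideanSpace ℝ (Fin (s + 1))) : (M.Sigma v).IsHermitian := by
  have h : (M.Psi v)ᵀ = M.Psi v := by
    ext i j
    simp [Psi, M.pattern_symm i j]
  rw [Matrix.IsHermitian, Matrix.conjTranspose_eq_transpose_of_trivial, Sigma,
    Matrix.transpose_add, Matrix.transpose_mul, Matrix.transpose_mul, h]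
  simp [Matrix.mul_assoc]

theorem posDef_Sigma {ψ : EuclideanSpace ℝ (Fin (s + 1))} (hψ : ψ ∈ M.paramSet) :
    (M.Sigma ψ).PosDef := by
  have h1 := hψ.1.mul_mul_conjTranspose_same M.Z
  rw [Matrix.conjTranspose_eq_transpose_of_trivial] at h1
  exact Matrix.PosDef.posSemidef_add h1 (Matrix.PosDef.one.smul hψ.2)

theorem A_smul (t : ℝ) (v ψ : EuclideanSpace ℝ (Fin (s + 1))) :
    M.A (t • v) ψ = t • M.A v ψ := by
  simp only [A, ← sigmaLinearMap_apply, map_smul, mul_smul_comm, smul_mul_assoc]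

theorem isHermitian_A (v ψ : EuclideanSpace ℝ (Fin (s + 1))) : (M.A v ψ).IsHermitian := by
  have hR := isHermitian_matInvSqrt (M.Sigma ψ)
  rw [Matrix.IsHermitian, A, Matrix.conjTranspose_mul, Matrix.conjTranspose_mul, hR.eq,
    (M.isHermitian_Sigma v).eq, mul_assoc]

/-- If `A` vanished at the normalized direction, `a` would take its default value 1, against `α <
1`. Homogeneity carries this to every nonzero `w`. -/
theorem matFrobeniusNorm_A_pos {ψ : EuclideanSpace ℝ (Fin (s + 1))} {α : ℝ}
    (hα : ∀ v : EuclideanSpace ℝ (Fin (s + 1)), ‖v‖ = 1 → M.a v ψ ≤ α) (hα1 : α < 1)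
    {w : EuclideanSpace ℝ (Fin (s + 1))} (hw : w ≠ 0) : 0 < matFrobeniusNorm (M.A w ψ) := by
  have hv := hα (‖w‖⁻¹ • w) (norm_smul_inv_norm hw)
  have hpos : 0 < matFrobeniusNorm (M.A (‖w‖⁻¹ • w) ψ) := by
    by_contra hcon
    rw [a, if_neg hcon] at hv
    linarith
  rw [A_smul, matFrobeniusNorm_smul] at hpos
  exact pos_of_mul_pos_right hpos (abs_nonneg _)

/-- The ratio of the two norms is invariant under scaling of `w`, so the bound on the unit sphere
extends to all directions. This is needed because `I^{-1/2} u` is not a unit vector in general. -/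
theorem matSpectralNorm_A_le {ψ : EuclideanSpace ℝ (Fin (s + 1))} {α : ℝ}
    (hα : ∀ v : EuclideanSpace ℝ (Fin (s + 1)), ‖v‖ = 1 → M.a v ψ ≤ α) (hα1 : α < 1)
    (w : EuclideanSpace ℝ (Fin (s + 1))) :
    matSpectralNorm (M.A w ψ) ≤ α * matFrobeniusNorm (M.A w ψ) := by
  by_cases hw : w = 0
  · have : M.A w ψ = (0 : ℝ) • M.A w ψ := by rw [← A_smul, hw, smul_zero]
    rw [this, matSpectralNorm_smul, matFrobeniusNorm_smul]
    simp
  have hw0 : ‖w‖ ≠ 0 := norm_ne_zero_iff.2 hw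
  have hu : ‖‖w‖⁻¹ • w‖ = 1 := norm_smul_inv_norm hw
  have hv := hα _ hu
  have hpos := M.matFrobeniusNorm_A_pos hα hα1 hw
  have hupos := M.matFrobeniusNorm_A_pos hα hα1 (w := ‖w‖⁻¹ • w) (fun h => by simp [h] at hu)
  rw [a, if_pos hupos, A_smul, matSpectralNorm_smul, matFrobeniusNorm_smul,
    mul_div_mul_left _ _ (by simpa using hw0), div_le_iff₀ hpos] at hv
  exact hv

/-- The map carrying the standard normal distribution to the distribution of the response. -/
noncomputable def response (β : EuclideanSpace ℝ (Fin p)) (ψ : EuclideanSpace ℝ (Fin (s + 1)))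
    (x : EuclideanSpace ℝ (Fin n)) : EuclideanSpace ℝ (Fin n) :=
  open scoped MatrixOrder in
  M.mean β + Matrix.toEuclideanCLM (n := Fin n) (𝕜 := ℝ) (CFC.sqrt (M.Sigma ψ)) x

theorem measurable_response (β : EuclideanSpace ℝ (Fin p))
    (ψ : EuclideanSpace ℝ (Fin (s + 1))) : Measurable (M.response β ψ) := by
  unfold response
  fun_prop

theorem ofLp_response_sub_mean (β : EuclideanSpace ℝ (Fin p))
    (ψ : EuclideanSpace ℝ (Fin (s + 1))) (x : EuclideanSpace ℝ (Fin n)) :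
    (M.response β ψ x - M.mean β).ofLp =
      (open scoped MatrixOrder in CFC.sqrt (M.Sigma ψ)) *ᵥ x.ofLp := by
  rw [response, add_sub_cancel_left]
  rfl

theorem inner_scorePsi (β : EuclideanSpace ℝ (Fin p)) {ψ : EuclideanSpace ℝ (Fin (s + 1))}
    (hψ : ψ ∈ M.paramSet) (h : EuclideanSpace ℝ (Fin (s + 1))) (y : EuclideanSpace ℝ (Fin n)) :
    inner ℝ h (M.scorePsi β ψ y) =
      1 / 2 * ((y - M.mean β).ofLp ⬝ᵥ
        (((M.Sigma ψ)⁻¹ * M.Sigma h * (M.Sigma ψ)⁻¹) *ᵥ (y - M.mean β).ofLp) -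
          ((M.Sigma ψ)⁻¹ * M.Sigma h).trace) := by
  -- With `β` held fixed, the mean is absorbed into the data and the mean map is zero.
  have := inner_gradient_gaussianLogLik M.sigmaLinearMap 0 (y - M.mean β).ofLp
    (M.posDef_Sigma hψ) h
  simp only [LinearMap.zero_apply, sub_zero, zero_dotProduct, zero_add] at this
  exact this

/-- `X β` as a linear map of `θ = (β, ψ)`. -/
noncomputable def meanLinearMap :
    EuclideanSpace ℝ (Fin p ⊕ Fin (s + 1)) →ₗ[ℝ] (Fin n → ℝ) where
  toFun θ := (M.mean (betaPart θ)).ofLp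
  map_add' _ _ := M.X.mulVec_add _ _
  map_smul' t _ := M.X.mulVec_smul t _

/-- The `ψ`-part of `θ` as a linear map. -/
def psiPartLinearMap :
    EuclideanSpace ℝ (Fin p ⊕ Fin (s + 1)) →ₗ[ℝ] EuclideanSpace ℝ (Fin (s + 1)) where
  toFun := psiPart
  map_add' _ _ := rfl
  map_smul' _ _ := rfl

theorem inner_score {θ : EuclideanSpace ℝ (Fin p ⊕ Fin (s + 1))} (hθ : psiPart θ ∈ M.paramSet)
    (h : EuclideanSpace ℝ (Fin p ⊕ Fin (s + 1))) (y : EuclideanSpace ℝ (Fin n)) :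
    inner ℝ h (M.score θ y) =
      (M.mean (betaPart h)).ofLp ⬝ᵥ
        ((M.Sigma (psiPart θ))⁻¹ *ᵥ (y - M.mean (betaPart θ)).ofLp) +
      1 / 2 * ((y - M.mean (betaPart θ)).ofLp ⬝ᵥ
        (((M.Sigma (psiPart θ))⁻¹ * M.Sigma (psiPart h) * (M.Sigma (psiPart θ))⁻¹) *ᵥ
          (y - M.mean (betaPart θ)).ofLp) -
          ((M.Sigma (psiPart θ))⁻¹ * M.Sigma (psiPart h)).trace) :=
  inner_gradient_gaussianLogLik (M.sigmaLinearMap ∘ₗ psiPartLinearMap) M.meanLinearMap y.ofLp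
    (M.posDef_Sigma hθ) h

theorem measurable_scorePsi (β : EuclideanSpace ℝ (Fin p)) {ψ : EuclideanSpace ℝ (Fin (s + 1))}
    (hψ : ψ ∈ M.paramSet) : Measurable (M.scorePsi β ψ) := by
  refine measurable_of_measurable_inner fun v => ?_
  simp only [M.inner_scorePsi β hψ]
  exact Continuous.measurable (by fun_prop)

theorem measurable_score {θ : EuclideanSpace ℝ (Fin p ⊕ Fin (s + 1))}
    (hθ : psiPart θ ∈ M.paramSet) : Measurable (M.score θ) := by
  refine measurable_of_measurable_inner fun v => ?_
  simp only [M.inner_score hθ]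
  exact Continuous.measurable (by fun_prop)

theorem inner_scorePsi_response (β : EuclideanSpace ℝ (Fin p))
    {ψ : EuclideanSpace ℝ (Fin (s + 1))} (hψ : ψ ∈ M.paramSet)
    (h : EuclideanSpace ℝ (Fin (s + 1))) (x : EuclideanSpace ℝ (Fin n)) :
    inner ℝ h (M.scorePsi β ψ (M.response β ψ x)) = gaussianQuadratic 0 (M.A h ψ) x := by
  have := score_sqrt_mulVec_eq_gaussianQuadratic (M.posDef_Sigma hψ) (M.Sigma h) 0 x
  rw [map_zero, WithLp.ofLp_zero, zero_dotProduct, zero_add] at this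
  rw [M.inner_scorePsi β hψ, ofLp_response_sub_mean, this, A]

theorem inner_score_response {θ : EuclideanSpace ℝ (Fin p ⊕ Fin (s + 1))}
    (hθ : psiPart θ ∈ M.paramSet) (h : EuclideanSpace ℝ (Fin p ⊕ Fin (s + 1)))
    (x : EuclideanSpace ℝ (Fin n)) :
    inner ℝ h (M.score θ (M.response (betaPart θ) (psiPart θ) x)) =
      gaussianQuadratic (Matrix.toEuclideanCLM (n := Fin n) (𝕜 := ℝ)
        (matInvSqrt (M.Sigma (psiPart θ))) (M.mean (betaPart h)))
        (M.A (psiPart h) (psiPart θ)) x := by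
  rw [M.inner_score hθ, ofLp_response_sub_mean,
    score_sqrt_mulVec_eq_gaussianQuadratic (M.posDef_Sigma hθ), A]

/-- `Σ(ψ)^{-1/2}` is invertible, and full column rank makes `X` injective. -/
theorem whitened_mean_ne_zero {ψ : EuclideanSpace ℝ (Fin (s + 1))} (hψ : ψ ∈ M.paramSet)
    (hX : M.X.rank = p) {b : EuclideanSpace ℝ (Fin p)} (hb : b ≠ 0) :
    Matrix.toEuclideanCLM (n := Fin n) (𝕜 := ℝ) (matInvSqrt (M.Sigma ψ)) (M.mean b) ≠ 0 := by
  intro h0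
  have hmean : M.mean b = 0 := by
    have h1 := congrArg (Matrix.toEuclideanCLM (n := Fin n) (𝕜 := ℝ)
      (matInvSqrt (M.Sigma ψ) * M.Sigma ψ)) h0
    have h2 : matInvSqrt (M.Sigma ψ) * M.Sigma ψ * matInvSqrt (M.Sigma ψ) = 1 :=
      matInvSqrt_mul_mul_matInvSqrt (M.posDef_Sigma hψ)
    rwa [map_zero, ← mul_apply_eq_comp, ← map_mul, h2, map_one, one_apply_eq_self] at h1
  have hinj : Function.Injective M.X.mulVec := by
    rw [Matrix.mulVec_injective_iff, linearIndependent_iff_card_eq_finrank_span,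
      Set.finrank, ← Matrix.rank_eq_finrank_span_cols, hX, Fintype.card_fin]
  apply hb
  have : M.X *ᵥ b.ofLp = M.X *ᵥ 0 := by
    rw [Matrix.mulVec_zero]
    exact congrArg WithLp.ofLp hmean
  exact WithLp.ofLp_injective 2 (hinj this)

end MixedModel

/-! ### Asymptotic normality of standardized scores -/

theorem measurable_inner_toEuclideanCLM {Ω κ : Type*} [MeasurableSpace Ω] [Fintype κ]
    [DecidableEq κ] {S : Ω → EuclideanSpace ℝ κ} (hS : Measurable S) (R : Matrix κ κ ℝ)
    (u : EuclideanSpace ℝ κ) :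
    Measurable fun y => inner ℝ u (Matrix.toEuclideanCLM (n := κ) (𝕜 := ℝ) R (S y)) := by
  fun_prop

/-- A standardized score is asymptotically standard normal when it is, in every direction, a
centred quadratic polynomial of a standard normal vector whose spectral norm is negligible
compared with its Frobenius norm. -/
theorem tendstoInDistribution_standardized {κ : ℕ+ → Type*} [∀ n, Fintype (κ n)]
    [∀ n, DecidableEq (κ n)]
    {S : (n : ℕ+) → EuclideanSpace ℝ (Fin n) → EuclideanSpace ℝ (κ n)}
    {T : (n : ℕ+) → EuclideanSpace ℝ (Fin n) → EuclideanSpace ℝ (Fin n)}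
    {c : (n : ℕ+) → EuclideanSpace ℝ (κ n) → EuclideanSpace ℝ (Fin n)}
    {A : (n : ℕ+) → EuclideanSpace ℝ (κ n) → Matrix (Fin n) (Fin n) ℝ}
    (hSm : ∀ n, Measurable (S n)) (hT : ∀ n, Measurable (T n))
    (hA : ∀ n h, (A n h).IsHermitian)
    (hS : ∀ n h x, inner ℝ h (S n (T n x)) = gaussianQuadratic (c n h) (A n h) x)
    (hI : ∀ᶠ n : ℕ+ in atTop,
      (covMatrix (S n) ((stdGaussian (EuclideanSpace ℝ (Fin n))).map (T n))).PosDef)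
    {α : ℕ+ → ℝ} (hα : Tendsto α atTop (𝓝 0))
    (hspec : ∀ᶠ n in atTop, ∀ h,
      matSpectralNorm (A n h) ≤ α n * matFrobeniusNorm (A n h))
    {Ω : ℕ+ → Type*} [∀ n, MeasurableSpace (Ω n)]
    {P : (n : ℕ+) → Measure (Ω n)} [∀ n, IsProbabilityMeasure (P n)]
    {Y : (n : ℕ+) → Ω n → EuclideanSpace ℝ (Fin n)}
    (hY : ∀ n, HasLaw (Y n) ((stdGaussian (EuclideanSpace ℝ (Fin n))).map (T n)) (P n))
    {u : (n : ℕ+) → EuclideanSpace ℝ (κ n)} (hu : ∀ n, ‖u n‖ = 1) :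
    TendstoInDistribution
      (fun n ω => inner ℝ (u n) (Matrix.toEuclideanCLM (n := κ n) (𝕜 := ℝ)
        (matInvSqrt (covMatrix (S n) ((stdGaussian (EuclideanSpace ℝ (Fin n))).map (T n))))
        (S n (Y n ω))))
      atTop (id : ℝ → ℝ) P (gaussianReal 0 1) := by
  have hmeas (n : ℕ+) := measurable_inner_toEuclideanCLM (hSm n)
    (matInvSqrt (covMatrix (S n) ((stdGaussian (EuclideanSpace ℝ (Fin n))).map (T n)))) (u n)
  -- Unit variance gives `‖A‖_F² / 2 ≤ 1`, so `‖A‖_F ≤ 2` suffices as a crude bound. The absolute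
  -- value is there because `α n` is not assumed nonnegative.
  refine tendstoInDistribution_of_map_eq_gaussianQuadratic (δ := fun n => 2 * |α n|)
    (fun n => (hmeas n).comp_aemeasurable (hY n).aemeasurable) (by simpa using hα.abs.const_mul 2)
    ?_
  filter_upwards [hI, hspec] with n hIn hspecn
  obtain ⟨h, hvar, hh⟩ := exists_standardized_eq_gaussianQuadratic (hSm n) (hT n) (hA n) (hS n)
    hIn (hu n)
  refine ⟨c n h, A n h, hA n h, hvar, ?_, ?_⟩
  · have hF0 : 0 ≤ matFrobeniusNorm (A n h) := Real.sqrt_nonneg _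
    have hF : matFrobeniusNorm (A n h) ≤ 2 := by nlinarith [sq_nonneg ‖c n h‖]
    calc matSpectralNorm (A n h) ≤ α n * matFrobeniusNorm (A n h) := hspecn h
      _ ≤ |α n| * matFrobeniusNorm (A n h) := by gcongr; exact le_abs_self _
      _ ≤ |α n| * 2 := by gcongr
      _ = 2 * |α n| := mul_comm _ _
  · have hcomp : (fun x => inner ℝ (u n) (Matrix.toEuclideanCLM (n := κ n) (𝕜 := ℝ)
        (matInvSqrt (covMatrix (S n) ((stdGaussian (EuclideanSpace ℝ (Fin n))).map (T n))))
        (S n x))) ∘ T n = gaussianQuadratic (c n h) (A n h) := funext hh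
    have hmap := AEMeasurable.map_map_of_aemeasurable (hmeas n).aemeasurable (hY n).aemeasurable
    rw [(hY n).map_eq, Measure.map_map (hmeas n) (hT n), hcomp] at hmap
    exact hmap.symm

/-! ### Nonsingular information, and the theorem -/

namespace MixedModel

variable {n p q s : ℕ} (M : MixedModel n p q s)

theorem posDef_infoPsi (β : EuclideanSpace ℝ (Fin p)) {ψ : EuclideanSpace ℝ (Fin (s + 1))}
    (hψ : ψ ∈ M.paramSet) {α : ℝ}
    (hα : ∀ v : EuclideanSpace ℝ (Fin (s + 1)), ‖v‖ = 1 → M.a v ψ ≤ α) (hα1 : α < 1) :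
    (M.infoPsi β ψ).PosDef := by
  refine posDef_covMatrix (M.measurable_scorePsi β hψ) (M.measurable_response β ψ)
    (c := fun _ => 0) (fun h => M.isHermitian_A h ψ) (M.inner_scorePsi_response β hψ)
    fun h hh => ?_
  have := M.matFrobeniusNorm_A_pos hα hα1 hh
  positivity

theorem posDef_info {θ : EuclideanSpace ℝ (Fin p ⊕ Fin (s + 1))}
    (hθ : psiPart θ ∈ M.paramSet) (hX : M.X.rank = p) {α : ℝ}
    (hα : ∀ v : EuclideanSpace ℝ (Fin (s + 1)), ‖v‖ = 1 → M.a v (psiPart θ) ≤ α)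
    (hα1 : α < 1) : (M.info θ).PosDef := by
  refine posDef_covMatrix (M.measurable_score hθ) (M.measurable_response _ _)
    (fun h => M.isHermitian_A (psiPart h) (psiPart θ)) (M.inner_score_response hθ)
    fun h hh => ?_
  -- Directions purely in `β` draw their variance from the linear term; in all others the quadratic
  -- term alone is positive.
  by_cases hw : psiPart h = 0
  · have hb : betaPart h ≠ 0 := by
      intro hb
      apply hh
      ext i
      rcases i with i | i
      · exact congrArg (fun z => z i) hb
      · exact congrArg (fun z => z i) hw
    have := norm_pos_iff.2 (M.whitened_mean_ne_zero hθ hX hb)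
    positivity
  · have := M.matFrobeniusNorm_A_pos hα hα1 hw
    positivity

end MixedModel

theorem theorem2
    (p q s : ℕ+ → ℕ) (M : (n : ℕ+) → MixedModel n (p n) (q n) (s n))
    (ψ : (n : ℕ+) → EuclideanSpace ℝ (Fin (s n + 1))) (hψ : ∀ n, ψ n ∈ (M n).paramSet)
    (abar : ℕ+ → ℝ)
    (habar : ∀ n, ∀ v : EuclideanSpace ℝ (Fin (s n + 1)), ‖v‖ = 1 → (M n).a v (ψ n) ≤ abar n)
    (habar_lim : Tendsto abar atTop (𝓝 0))
    {Ω : ℕ+ → Type*} [∀ n, MeasurableSpace (Ω n)]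
    (P : (n : ℕ+) → Measure (Ω n)) [∀ n, IsProbabilityMeasure (P n)] :
    -- known `β = 0`
    ((∀ᶠ n in atTop, ((M n).infoPsi 0 (ψ n)).PosDef) ∧
      ∀ Y : (n : ℕ+) → Ω n → EuclideanSpace ℝ (Fin n),
        (∀ n, HasLaw (Y n) ((M n).law 0 (ψ n)) (P n)) →
        ∀ v : (n : ℕ+) → EuclideanSpace ℝ (Fin (s n + 1)), (∀ n, ‖v n‖ = 1) →
          TendstoInDistribution
            (fun n ω => inner ℝ (v n) ((M n).stdScorePsi 0 (ψ n) (Y n ω)))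
            atTop (id : ℝ → ℝ) P (gaussianReal 0 1)) ∧
    -- unknown `β`, design matrices of full column rank
    ((∀ n, (M n).X.rank = p n) →
      ∀ θ : (n : ℕ+) → EuclideanSpace ℝ (Fin (p n) ⊕ Fin (s n + 1)),
        (∀ n, MixedModel.psiPart (θ n) = ψ n) →
        (∀ᶠ n in atTop, ((M n).info (θ n)).PosDef) ∧
        ∀ Y : (n : ℕ+) → Ω n → EuclideanSpace ℝ (Fin n),
          (∀ n, HasLaw (Y n) ((M n).law (MixedModel.betaPart (θ n)) (ψ n)) (P n)) →
          ∀ u : (n : ℕ+) → EuclideanSpace ℝ (Fin (p n) ⊕ Fin (s n + 1)), (∀ n, ‖u n‖ = 1) →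
            TendstoInDistribution
              (fun n ω => inner ℝ (u n) ((M n).stdScore (θ n) (Y n ω)))
              atTop (id : ℝ → ℝ) P (gaussianReal 0 1)) := by
  have hlt : ∀ᶠ n in atTop, abar n < 1 := habar_lim.eventually_lt_const one_pos
  refine ⟨?_, fun hX θ hθ => ?_⟩
  · have hI : ∀ᶠ n in atTop, ((M n).infoPsi 0 (ψ n)).PosDef := by
      filter_upwards [hlt] with n hn
      exact (M n).posDef_infoPsi 0 (hψ n) (habar n) hn
    refine ⟨hI, fun Y hY v hv => ?_⟩
    -- `hI` and `hY` fit by unfolding: `infoPsi` is a `covMatrix`, and `law` is the image of the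
    -- standard Gaussian under `response`.
    refine tendstoInDistribution_standardized (c := fun n _ => 0)
      (A := fun n h => (M n).A h (ψ n))
      (fun n => (M n).measurable_scorePsi 0 (hψ n)) (fun n => (M n).measurable_response 0 (ψ n))
      (fun n h => (M n).isHermitian_A h (ψ n)) (fun n => (M n).inner_scorePsi_response 0 (hψ n))
      hI habar_lim ?_ hY hv
    filter_upwards [hlt] with n hn h
    exact (M n).matSpectralNorm_A_le (habar n) hn h
  · obtain rfl : (fun n => MixedModel.psiPart (θ n)) = ψ := funext hθ
    have hI : ∀ᶠ n in atTop, ((M n).info (θ n)).PosDef := by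
      filter_upwards [hlt] with n hn
      exact (M n).posDef_info (hψ n) (hX n) (habar n) hn
    refine ⟨hI, fun Y hY u hu => ?_⟩
    refine tendstoInDistribution_standardized
      (fun n => (M n).measurable_score (hψ n)) (fun n => (M n).measurable_response _ _)
      (fun n h => (M n).isHermitian_A (MixedModel.psiPart h) (MixedModel.psiPart (θ n)))
      (fun n => (M n).inner_score_response (hψ n)) hI habar_lim ?_ hY hu
    filter_upwards [hlt] with n hn h
    exact (M n).matSpectralNorm_A_le (habar n) hn _
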